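/- For a real number $a$ and an integer $n\ge 0$ let $(a)_n = a(a+1)\cdots(a+n-1)$, with $(a)_0=1$, denote the Pochhammer symbol (rising factorial). Then the following two series converge absolutely, with the indicated sums: $$\sum_{n\ge 0} \frac{(1/2)_n^7}{(1)_n^7}\,\frac{1}{2^{6n}}\,\bigl(168n^3+76n^2+14n+1\bigr) = \frac{32}{\pi^3},$$ $$\sum_{n\ge 1} \frac{(1)_n^7}{(1/2)_n^7}\,\frac{1}{2^{6n}}\,\frac{21n^3-22n^2+8n-1}{n^7} = \frac{\pi^4}{8}.$$ -/

import Mathlib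

/-- The Pochhammer symbol (rising factorial) `(a)_n = a (a + 1) ⋯ (a + n - 1)`, with `(a)_0 = 1`. -/
noncomputable def pochhammerSymbol (a : ℝ) (n : ℕ) : ℝ :=
  (ascPochhammer ℝ n).eval a

open Filter Topology

/-! Both sums come from deforming the summand by a parameter, showing how the sum changes under a
unit shift of it, and evaluating where the series collapses to one term.

For `1/π³` the parameter is a natural number `k`. The pair `wzG`, `wzF` satisfies the WZ equation
(`wz_equation`), so the sum of `wzG n k` over `n` is independent of `k` (`tsum_wzG_eq`). At `k = 0`
it is the required series. As `k → ∞` the terms with `n ≥ 1` die out, while `wzG 0 k` is a product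
of three Wallis ratios tending to `2/π` and a rational factor tending to `4`.

For `π⁴` the parameter is a complex `x`. A telescoping certificate (`term_add_one_sub`) gives a
first-order recurrence for the sum under `x ↦ x + 1`. Multiplying by the square of the Gamma
quotient `kernel` makes it 1-periodic. The product is holomorphic and bounded on a strip, so it
extends to a bounded entire function and is constant by Liouville. At `x = 1/2` only one term
survives and the value is `8π²`; at `x = 0` it is `16/π²` times four times the required series. -/

theorem pochhammerSymbol_zero (a : ℝ) : pochhammerSymbol a 0 = 1 := by
  simp [pochhammerSymbol]

theorem pochhammerSymbol_succ (a : ℝ) (n : ℕ) :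
    pochhammerSymbol a (n + 1) = pochhammerSymbol a n * (a + n) := by
  simp [pochhammerSymbol, ascPochhammer_succ_right]

theorem pochhammerSymbol_one (n : ℕ) : pochhammerSymbol 1 n = n.factorial := by
  induction n with
  | zero => simp [pochhammerSymbol_zero]
  | succ n ih => rw [pochhammerSymbol_succ, ih, Nat.factorial_succ]; push_cast; ring

theorem pochhammerSymbol_half_pos (n : ℕ) : 0 < pochhammerSymbol (1 / 2) n := by
  induction n with
  | zero => simp [pochhammerSymbol_zero]
  | succ n ih => rw [pochhammerSymbol_succ]; positivity

theorem factorial_two_mul_eq (n : ℕ) :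
    ((2 * n).factorial : ℝ) = 4 ^ n * n.factorial * pochhammerSymbol (1 / 2) n := by
  induction n with
  | zero => simp [pochhammerSymbol_zero]
  | succ n ih =>
    rw [show 2 * (n + 1) = 2 * n + 1 + 1 by ring, Nat.factorial_succ, Nat.factorial_succ,
      Nat.factorial_succ, pochhammerSymbol_succ]
    push_cast
    rw [ih]
    ring

/-! ### The series for `32/π³`: a Wilf–Zeilberger pair. -/

namespace RamanujanPiCubed

/-- The hypergeometric part of the Wilf–Zeilberger pair. -/
noncomputable def hyp (n k : ℕ) : ℝ :=
  pochhammerSymbol (1 / 2) (n + 2 * k) ^ 4 * pochhammerSymbol (1 / 2) n ^ 4 /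
    ((n + k).factorial ^ 4 * (n + 2 * k).factorial * n.factorial *
      (2 * n + 2 * k + 1).factorial * 16 ^ (n + k))

/-- The polynomial part of `wzG`. -/
def polyG (n k : ℝ) : ℝ :=
  336 * n ^ 4 + 1344 * n ^ 3 * k + 320 * n ^ 3 + 1920 * n ^ 2 * k ^ 2 + 960 * n ^ 2 * k +
    104 * n ^ 2 + 1152 * n * k ^ 3 + 896 * n * k ^ 2 + 208 * n * k + 16 * n + 256 * k ^ 4 +
    256 * k ^ 3 + 96 * k ^ 2 + 16 * k + 1

/-- The polynomial part of `wzF`. -/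
def polyF (n k : ℝ) : ℝ :=
  336 * n ^ 4 + 1984 * n ^ 3 * k + 640 * n ^ 3 + 4352 * n ^ 2 * k ^ 2 + 2752 * n ^ 2 * k +
    392 * n ^ 2 + 4224 * n * k ^ 3 + 3968 * n * k ^ 2 + 1136 * n * k + 96 * n + 1536 * k ^ 4 +
    1920 * k ^ 3 + 832 * k ^ 2 + 144 * k + 9

/-- The summand whose sum over `n` does not depend on `k`. -/
noncomputable def wzG (n k : ℕ) : ℝ := hyp n k * polyG n k

/-- The Wilf–Zeilberger mate of `wzG`. -/
noncomputable def wzF (n k : ℕ) : ℝ := hyp n k * polyF n k * (n / (n + 2 * k + 1))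

theorem hyp_pos (n k : ℕ) : 0 < hyp n k := by
  have := pochhammerSymbol_half_pos (n + 2 * k)
  have := pochhammerSymbol_half_pos n
  unfold hyp
  positivity

theorem hyp_succ_left (n k : ℕ) :
    hyp (n + 1) k = hyp n k * ((n + 2 * k + 1 / 2) ^ 4 * (n + 1 / 2) ^ 4 /
      ((n + k + 1) ^ 4 * (n + 2 * k + 1) * (n + 1) * (2 * n + 2 * k + 2) *
        (2 * n + 2 * k + 3) * 16)) := by
  unfold hyp
  rw [show n + 1 + 2 * k = n + 2 * k + 1 by ring, show n + 1 + k = n + k + 1 by ring,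
    show 2 * (n + 1) + 2 * k + 1 = 2 * n + 2 * k + 1 + 1 + 1 by ring,
    pochhammerSymbol_succ, pochhammerSymbol_succ, Nat.factorial_succ, Nat.factorial_succ,
    Nat.factorial_succ, Nat.factorial_succ, Nat.factorial_succ (2 * n + 2 * k + 1)]
  have := Nat.factorial_pos (n + k)
  have := Nat.factorial_pos (n + 2 * k)
  have := Nat.factorial_pos n
  have := Nat.factorial_pos (2 * n + 2 * k + 1)
  push_cast
  field_simp
  ring

theorem hyp_succ_right (n k : ℕ) :
    hyp n (k + 1) = hyp n k * ((n + 2 * k + 1 / 2) ^ 4 * (n + 2 * k + 3 / 2) ^ 4 /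
      ((n + k + 1) ^ 4 * (n + 2 * k + 1) * (n + 2 * k + 2) * (2 * n + 2 * k + 2) *
        (2 * n + 2 * k + 3) * 16)) := by
  unfold hyp
  rw [show n + 2 * (k + 1) = n + 2 * k + 1 + 1 by ring, show n + (k + 1) = n + k + 1 by ring,
    show 2 * n + 2 * (k + 1) + 1 = 2 * n + 2 * k + 1 + 1 + 1 by ring,
    pochhammerSymbol_succ, pochhammerSymbol_succ, Nat.factorial_succ,
    Nat.factorial_succ (n + 2 * k + 1), Nat.factorial_succ (n + 2 * k),
    Nat.factorial_succ (2 * n + 2 * k + 1 + 1), Nat.factorial_succ (2 * n + 2 * k + 1)]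
  have := Nat.factorial_pos (n + k)
  have := Nat.factorial_pos (n + 2 * k)
  have := Nat.factorial_pos n
  have := Nat.factorial_pos (2 * n + 2 * k + 1)
  push_cast
  field_simp
  ring

theorem wz_equation (n k : ℕ) :
    wzG n (k + 1) - wzG n k = wzF (n + 1) k - wzF n k := by
  unfold wzG wzF
  rw [hyp_succ_left, hyp_succ_right]
  unfold polyG polyF
  generalize hyp n k = c
  push_cast
  generalize hn : (n : ℝ) = x
  generalize hk : (k : ℝ) = y
  have hx : 0 ≤ x := hn ▸ n.cast_nonneg
  have hy : 0 ≤ y := hk ▸ k.cast_nonneg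
  have e : x + 1 + 2 * y + 1 = x + 2 * y + 2 := by ring
  rw [e]
  field_simp
  ring

/-- The WZ equation telescopes in `n`; the lower boundary term is absent because `wzF` carries a
factor `n`. -/
theorem sum_range_wzG_succ (N k : ℕ) :
    ∑ n ∈ Finset.range N, wzG n (k + 1) = ∑ n ∈ Finset.range N, wzG n k + wzF N k := by
  induction N with
  | zero => simp [wzF]
  | succ N ih =>
    rw [Finset.sum_range_succ, Finset.sum_range_succ, ih]
    linarith [wz_equation N k]

/-! ### Geometric bounds uniform in `k`. -/

theorem hyp_succ_left_le (n k : ℕ) : hyp (n + 1) k ≤ hyp n k * (1 / 4) := by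
  rw [hyp_succ_left]
  refine mul_le_mul_of_nonneg_left ?_ (hyp_pos n k).le
  rw [div_le_iff₀ (by positivity)]
  -- This absorbs `16 (n + k + 1)⁴` from the denominator; the `1/4` comes from halving the two
  -- factors of size about `2n + 2k`.
  have h1 : ((n : ℝ) + 2 * k + 1 / 2) ^ 4 ≤ (2 * (n + k + 1)) ^ 4 := by
    gcongr; linarith [n.cast_nonneg (α := ℝ)]
  have h2 : ((n : ℝ) + 1 / 2) ^ 4 ≤
      (n + 2 * k + 1) * (n + 1) * ((2 * n + 2 * k + 2) / 2) * ((2 * n + 2 * k + 3) / 2) := by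
    have hk := k.cast_nonneg (α := ℝ)
    calc ((n : ℝ) + 1 / 2) ^ 4 = (n + 1 / 2) * (n + 1 / 2) * (n + 1 / 2) * (n + 1 / 2) := by ring
      _ ≤ _ := by gcongr <;> linarith
  calc _ ≤ (2 * ((n : ℝ) + k + 1)) ^ 4 * ((n + 2 * k + 1) * (n + 1) *
        ((2 * n + 2 * k + 2) / 2) * ((2 * n + 2 * k + 3) / 2)) :=
        mul_le_mul h1 h2 (by positivity) (by positivity)
    _ = _ := by ring

/-- The true ratio is of order `k⁻³`; one power of `k` is enough to make the terms with `n ≥ 1`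
vanish in the limit. -/
theorem hyp_one_le (k : ℕ) : hyp 1 k ≤ hyp 0 k * (1 / (k + 1)) := by
  have h := hyp_succ_left 0 k
  rw [zero_add] at h
  rw [h]
  refine mul_le_mul_of_nonneg_left ?_ (hyp_pos 0 k).le
  rw [div_le_div_iff₀ (by positivity) (by positivity)]
  have hk := k.cast_nonneg (α := ℝ)
  have h1 : ((0 : ℕ) + 2 * (k : ℝ) + 1 / 2) ^ 4 ≤ (2 * (k + 1)) ^ 4 := by
    push_cast; gcongr; linarith
  calc _ ≤ (2 * ((k : ℝ) + 1)) ^ 4 * (1 * 1 * 1) * ((k : ℝ) + 1) := by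
        push_cast at h1 ⊢
        gcongr
        norm_num
    _ = ((k : ℝ) + 1) ^ 4 * 1 * 1 * ((k : ℝ) + 1) * 1 * 16 := by ring
    _ ≤ _ := by
        push_cast
        rw [one_mul]
        gcongr <;> linarith

theorem hyp_le (n k : ℕ) : hyp n k ≤ hyp 0 k * (1 / 4) ^ n := by
  induction n with
  | zero => simp
  | succ n ih =>
    calc _ ≤ hyp n k * (1 / 4) := hyp_succ_left_le n k
      _ ≤ hyp 0 k * (1 / 4) ^ n * (1 / 4) := by gcongr
      _ = _ := by ring

theorem hyp_succ_le (n k : ℕ) : hyp (n + 1) k ≤ hyp 1 k * (1 / 4) ^ n := by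
  induction n with
  | zero => simp
  | succ n ih =>
    calc _ ≤ hyp (n + 1) k * (1 / 4) := hyp_succ_left_le (n + 1) k
      _ ≤ hyp 1 k * (1 / 4) ^ n * (1 / 4) := by gcongr
      _ = _ := by ring

theorem polyG_nonneg (n k : ℕ) : 0 ≤ polyG n k := by unfold polyG; positivity

theorem polyF_nonneg (n k : ℕ) : 0 ≤ polyF n k := by unfold polyF; positivity

theorem add_add_one_pow_le (n k : ℕ) :
    ((n : ℝ) + k + 1) ^ 4 ≤ (n + 1) ^ 4 * (k + 1) ^ 4 := by
  rw [← mul_pow]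
  gcongr
  nlinarith [mul_nonneg n.cast_nonneg (α := ℝ) k.cast_nonneg]

/-- With `336`, the coefficient of `n⁴`, the difference `336 (n + k + 1)⁴ - polyG n k` expands with
nonnegative coefficients. For `polyF` the coefficient `1536` of `k⁴` plays this role. -/
theorem polyG_le (n k : ℕ) : polyG n k ≤ 336 * ((n + 1) ^ 4 * (k + 1) ^ 4) := by
  refine le_trans ?_ (mul_le_mul_of_nonneg_left (add_add_one_pow_le n k) (by norm_num))
  rw [← sub_nonneg]
  unfold polyG
  ring_nf
  positivity

theorem polyF_le (n k : ℕ) : polyF n k ≤ 1536 * ((n + 1) ^ 4 * (k + 1) ^ 4) := by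
  refine le_trans ?_ (mul_le_mul_of_nonneg_left (add_add_one_pow_le n k) (by norm_num))
  rw [← sub_nonneg]
  unfold polyF
  ring_nf
  positivity

theorem wzG_nonneg (n k : ℕ) : 0 ≤ wzG n k :=
  mul_nonneg (hyp_pos n k).le (polyG_nonneg n k)

theorem summable_pow_four_mul_geometric :
    Summable fun n : ℕ => ((n : ℝ) + 1) ^ 4 * (1 / 4) ^ n := by
  have h : Summable fun n : ℕ => (n : ℝ) ^ 4 * (1 / 4) ^ n :=
    summable_pow_mul_geometric_of_norm_lt_one 4 (by norm_num)
  refine (((summable_nat_add_iff 1).2 h).mul_left 4).congr fun n => ?_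
  push_cast
  ring

theorem summable_wzG (k : ℕ) : Summable fun n => wzG n k := by
  refine Summable.of_nonneg_of_le (wzG_nonneg · k) (fun n => ?_)
    (summable_pow_four_mul_geometric.mul_left (hyp 0 k * 336 * (k + 1) ^ 4))
  calc wzG n k ≤ hyp 0 k * (1 / 4) ^ n * (336 * ((n + 1) ^ 4 * (k + 1) ^ 4)) :=
        mul_le_mul (hyp_le n k) (polyG_le n k) (polyG_nonneg n k)
          (mul_nonneg (hyp_pos 0 k).le (by positivity))
    _ = _ := by ring

theorem tendsto_wzF_atTop (k : ℕ) : Tendsto (fun n => wzF n k) atTop (𝓝 0) := by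
  have h := (summable_pow_four_mul_geometric.mul_left
    (hyp 0 k * 1536 * (k + 1) ^ 4)).tendsto_atTop_zero
  refine squeeze_zero (fun n => ?_) (fun n => ?_) h
  · exact mul_nonneg (mul_nonneg (hyp_pos n k).le (polyF_nonneg n k)) (by positivity)
  · have h1 : (n : ℝ) / (n + 2 * k + 1) ≤ 1 := by
      rw [div_le_one (by positivity)]
      linarith [k.cast_nonneg (α := ℝ)]
    calc wzF n k ≤ hyp n k * polyF n k * 1 :=
          mul_le_mul_of_nonneg_left h1 (mul_nonneg (hyp_pos n k).le (polyF_nonneg n k))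
      _ ≤ hyp 0 k * (1 / 4) ^ n * (1536 * ((n + 1) ^ 4 * (k + 1) ^ 4)) := by
          rw [mul_one]
          exact mul_le_mul (hyp_le n k) (polyF_le n k) (polyF_nonneg n k)
            (mul_nonneg (hyp_pos 0 k).le (by positivity))
      _ = _ := by ring

theorem tsum_wzG_eq (k : ℕ) : ∑' n, wzG n k = ∑' n, wzG n 0 := by
  induction k with
  | zero => rfl
  | succ k ih =>
    rw [← ih]
    refine tendsto_nhds_unique (summable_wzG (k + 1)).hasSum.tendsto_sum_nat ?_
    simp only [sum_range_wzG_succ]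
    simpa using (summable_wzG k).hasSum.tendsto_sum_nat.add (tendsto_wzF_atTop k)

/-! ### The limit `k → ∞` through Wallis' product. -/

/-- The ratio `(1/2)_m / (1)_m`. -/
noncomputable def halfRatio (m : ℕ) : ℝ := pochhammerSymbol (1 / 2) m / m.factorial

theorem halfRatio_sq_mul (m : ℕ) :
    halfRatio m ^ 2 * (2 * m + 1) = (Real.Wallis.W m)⁻¹ := by
  induction m with
  | zero => simp [halfRatio, pochhammerSymbol_zero, Real.Wallis.W]
  | succ m ih =>
    rw [Real.Wallis.W_succ, mul_inv, ← ih]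
    unfold halfRatio
    rw [pochhammerSymbol_succ, Nat.factorial_succ]
    have := Nat.factorial_pos m
    push_cast
    field_simp
    ring

theorem tendsto_halfRatio_sq_mul :
    Tendsto (fun m : ℕ => halfRatio m ^ 2 * (2 * m + 1)) atTop (𝓝 (2 / Real.pi)) := by
  simp only [halfRatio_sq_mul]
  have := Real.tendsto_prod_pi_div_two.inv₀ (by positivity)
  rw [inv_div] at this
  exact this

/-- Here `polyG 0 k = (4k + 1)⁴`: two of these factors complete the Wallis ratios at `2k`, the other
two go into the last square. -/
theorem wzG_zero_left (k : ℕ) :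
    wzG 0 k = (halfRatio (2 * k) ^ 2 * (2 * (2 * k : ℕ) + 1)) ^ 2 *
      (halfRatio k ^ 2 * (2 * k + 1)) * ((4 * k + 1) / (2 * k + 1)) ^ 2 := by
  unfold wzG hyp halfRatio polyG
  have h := factorial_two_mul_eq k
  simp only [mul_zero, zero_add, Nat.factorial_succ, pochhammerSymbol_zero, Nat.factorial_zero]
  have h4 : (4 : ℝ) ^ k * 4 ^ k = 16 ^ k := by rw [← mul_pow]; norm_num
  have := Nat.factorial_pos k
  have := pochhammerSymbol_half_pos k
  rw [← h4]
  push_cast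
  rw [h]
  field_simp
  ring

theorem tendsto_wzG_zero_left :
    Tendsto (fun k => wzG 0 k) atTop (𝓝 (32 / Real.pi ^ 3)) := by
  simp only [wzG_zero_left]
  have h2 : Tendsto (fun k : ℕ => 2 * k) atTop atTop :=
    tendsto_id.const_mul_atTop' (by norm_num)
  have h3 : Tendsto (fun k : ℕ => (4 * (k : ℝ) + 1) / (2 * k + 1)) atTop (𝓝 2) := by
    have : Tendsto (fun k : ℕ => 2 - 1 / (2 * (k : ℝ) + 1)) atTop (𝓝 (2 - 0)) := by
      refine tendsto_const_nhds.sub ?_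
      refine tendsto_const_nhds.div_atTop ?_
      exact tendsto_atTop_add_const_right _ _
        (tendsto_natCast_atTop_atTop.const_mul_atTop (by norm_num))
    rw [sub_zero] at this
    refine this.congr fun k => ?_
    field_simp
    ring
  have := (((tendsto_halfRatio_sq_mul.comp h2).pow 2).mul tendsto_halfRatio_sq_mul).mul (h3.pow 2)
  rw [show 32 / Real.pi ^ 3 = (2 / Real.pi) ^ 2 * (2 / Real.pi) * 2 ^ 2 by field_simp; norm_num]
  exact this

theorem tendsto_tsum_wzG_succ :
    Tendsto (fun k => ∑' n, wzG (n + 1) k) atTop (𝓝 0) := by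
  obtain ⟨C, hC⟩ := tendsto_wzG_zero_left.bddAbove_range
  -- The convergent sequence `wzG 0 k` is bounded and `polyG 0 k = (4k + 1)⁴` dominates `(k + 1)⁴`.
  -- This cancels the growth of `polyG` in `k` and leaves the decay `1 / (k + 1)`.
  have hC' : ∀ k, hyp 0 k * (k + 1) ^ 4 ≤ C := fun k => by
    refine le_trans ?_ (hC ⟨k, rfl⟩)
    refine mul_le_mul_of_nonneg_left ?_ (hyp_pos 0 k).le
    rw [← sub_nonneg]
    unfold polyG
    push_cast
    ring_nf
    positivity
  have hs : Summable fun n : ℕ => ((n : ℝ) + 1 + 1) ^ 4 * (1 / 4) ^ n := by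
    refine (((summable_nat_add_iff 1).2 summable_pow_four_mul_geometric).mul_left 4).congr
      fun n => ?_
    push_cast
    ring
  have hle : ∀ n k, wzG (n + 1) k ≤
      C * 336 * (1 / ((k : ℝ) + 1)) * (((n : ℝ) + 1 + 1) ^ 4 * (1 / 4) ^ n) := fun n k => by
    have h1 : hyp (n + 1) k ≤ hyp 0 k * (1 / (k + 1)) * (1 / 4) ^ n :=
      (hyp_succ_le n k).trans (by gcongr; exact hyp_one_le k)
    have h2 := polyG_le (n + 1) k
    push_cast at h2
    have h0 := (hyp_pos 0 k).le
    have h3 := polyG_nonneg (n + 1) k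
    push_cast at h3
    calc wzG (n + 1) k ≤ hyp 0 k * (1 / (k + 1)) * (1 / 4) ^ n *
          (336 * (((n : ℝ) + 1 + 1) ^ 4 * (k + 1) ^ 4)) := by
          unfold wzG
          push_cast
          exact mul_le_mul h1 h2 h3 (by positivity)
      _ = (hyp 0 k * (k + 1) ^ 4) * (336 * (1 / ((k : ℝ) + 1)) *
          (((n : ℝ) + 1 + 1) ^ 4 * (1 / 4) ^ n)) := by ring
      _ ≤ C * (336 * (1 / ((k : ℝ) + 1)) * (((n : ℝ) + 1 + 1) ^ 4 * (1 / 4) ^ n)) := by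
          gcongr
          exact hC' k
      _ = _ := by ring
  have hlim : Tendsto (fun k : ℕ => C * 336 * (1 / ((k : ℝ) + 1)) *
      ∑' n : ℕ, ((n : ℝ) + 1 + 1) ^ 4 * (1 / 4) ^ n) atTop (𝓝 0) := by
    have := (tendsto_one_div_add_atTop_nhds_zero_nat (𝕜 := ℝ)).const_mul (C * 336)
    simpa using this.mul_const (∑' n : ℕ, ((n : ℝ) + 1 + 1) ^ 4 * (1 / 4) ^ n)
  refine squeeze_zero (fun k => tsum_nonneg fun n => wzG_nonneg _ _) (fun k => ?_) hlim
  rw [← tsum_mul_left]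
  exact Summable.tsum_le_tsum (hle · k) ((summable_nat_add_iff 1).2 (summable_wzG k))
    (hs.mul_left _)

theorem hasSum_wzG_zero : HasSum (fun n => wzG n 0) (32 / Real.pi ^ 3) := by
  have h : Tendsto (fun k => ∑' n, wzG n k) atTop (𝓝 (32 / Real.pi ^ 3 + 0)) := by
    refine (tendsto_wzG_zero_left.add tendsto_tsum_wzG_succ).congr fun k => ?_
    exact ((summable_wzG k).tsum_eq_zero_add).symm
  simp only [tsum_wzG_eq, add_zero] at h
  rw [← tendsto_nhds_unique tendsto_const_nhds h]
  exact (summable_wzG 0).hasSum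

/-- At `k = 0` the polynomial is `2n + 1` times the cubic, and `2n + 1` cancels against `(2n + 1)!`.
-/
theorem wzG_zero_right (n : ℕ) :
    wzG n 0 = pochhammerSymbol (1 / 2) n ^ 7 / pochhammerSymbol 1 n ^ 7 * (1 / 2 ^ (6 * n)) *
      (168 * (n : ℝ) ^ 3 + 76 * (n : ℝ) ^ 2 + 14 * (n : ℝ) + 1) := by
  unfold wzG hyp polyG
  have h := factorial_two_mul_eq n
  simp only [mul_zero, add_zero, Nat.factorial_succ, pochhammerSymbol_one]
  have h4 : (2 : ℝ) ^ (6 * n) = 16 ^ n * 4 ^ n := by rw [pow_mul, ← mul_pow]; norm_num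
  have := Nat.factorial_pos n
  have := pochhammerSymbol_half_pos n
  rw [h4]
  push_cast
  rw [h]
  field_simp
  ring

end RamanujanPiCubed

/-! ### The series for `π⁴/8`: a complex deformation and its telescoping. -/

namespace RamanujanPiFourth

/-- The factor of the summand that depends on the auxiliary variable `x`. -/
noncomputable def prodTerm (n : ℕ) (x : ℂ) : ℂ :=
  ∏ j ∈ Finset.range n, (((j : ℂ) + 1) ^ 2 - 4 * x ^ 2) / (((j : ℂ) + 3 / 2) ^ 2 - x ^ 2)

/-- The factor `n!³ / ((1/2)_{n+1}³ 64ⁿ)` of the summand. -/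
noncomputable def coeff (n : ℕ) : ℝ :=
  n.factorial ^ 3 / (pochhammerSymbol (1 / 2) (n + 1) ^ 3 * 64 ^ n)

/-- The polynomial factor of the summand. -/
def poly (n x : ℂ) : ℂ := (3 * n + 2) * (7 * n ^ 2 + 9 * n + 3 - 4 * x ^ 2)

/-- The summand, deformed by the auxiliary variable `x`. -/
noncomputable def term (n : ℕ) (x : ℂ) : ℂ := prodTerm n x ^ 2 * coeff n * poly n x

/-- The telescoping companion of `term`. -/
noncomputable def companion (n : ℕ) (x : ℂ) : ℂ :=
  -((x * (x + 3 / 2) * prodTerm n x) ^ 2 * coeff n *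
    (128 * (2 * x + 1) * n * (n + 1 / 2) ^ 3 * (n + 1 / 2 - x) ^ 2 /
      ((n - 1 - 2 * x) ^ 2 * (n - 2 * x) ^ 2)))

theorem prodTerm_succ (n : ℕ) (x : ℂ) :
    prodTerm (n + 1) x = prodTerm n x *
      ((((n : ℂ) + 1) ^ 2 - 4 * x ^ 2) / (((n : ℂ) + 3 / 2) ^ 2 - x ^ 2)) :=
  Finset.prod_range_succ _ _

theorem coeff_succ (n : ℕ) :
    coeff (n + 1) = coeff n * ((n + 1) ^ 3 / (64 * (n + 3 / 2) ^ 3)) := by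
  unfold coeff
  rw [pochhammerSymbol_succ _ (n + 1), Nat.factorial_succ]
  have := pochhammerSymbol_half_pos (n + 1)
  push_cast
  field_simp
  ring

theorem coeff_zero : coeff 0 = 8 := by
  simp [coeff, pochhammerSymbol_succ, pochhammerSymbol_zero]
  norm_num

theorem coeff_nonneg (n : ℕ) : 0 ≤ coeff n := by
  have := pochhammerSymbol_half_pos (n + 1)
  unfold coeff
  positivity

theorem coeff_le (n : ℕ) : coeff n ≤ 8 * (1 / 64) ^ n := by
  induction n with
  | zero => simp [coeff_zero]
  | succ n ih =>
    rw [coeff_succ, pow_succ (1 / 64 : ℝ), ← mul_assoc]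
    refine mul_le_mul ih ?_ (by positivity) (by positivity)
    rw [div_le_div_iff₀ (by positivity) (by norm_num)]
    have : ((n : ℝ) + 1) ^ 3 ≤ (n + 3 / 2) ^ 3 := by gcongr; norm_num
    linarith

theorem term_neg (n : ℕ) (x : ℂ) : term n (-x) = term n x := by
  simp [term, prodTerm, poly]

theorem ne_zero_of_re_pos {z : ℂ} (h : 0 < z.re) : z ≠ 0 := by
  rintro rfl
  simp at h

theorem natCast_sub_one_sub_ne_zero (n : ℕ) {x : ℂ} (h2 : x.re < 0) (h3 : 2 * x + 1 ≠ 0) :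
    (n : ℂ) - 1 - 2 * x ≠ 0 := by
  rcases n with _ | n
  · intro h
    apply h3
    simp at h
    linear_combination -h
  · exact ne_zero_of_re_pos (by simp; linarith [n.cast_nonneg (α := ℝ)])

/-- The linear factors `j + 1 ± 2x` and `j + 3/2 ± x` move by two steps and one step in `j`, so only
boundary factors of the product change. -/
theorem prodTerm_add_one (n : ℕ) {x : ℂ} (h1 : -1 < x.re) (h2 : x.re < 0)
    (h3 : 2 * x + 1 ≠ 0) :
    (1 + x) * (1 / 2 - x) * prodTerm n (x + 1) = x * (x + 3 / 2) * prodTerm n x *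
        ((n + 1 + 2 * x) * (n + 2 + 2 * x) * (n + 1 / 2 - x) / (((n : ℂ) - 1 - 2 * x) *
          (n - 2 * x) * (n + 3 / 2 + x))) := by
  induction n with
  | zero =>
    have m1 : (0 : ℂ) - 1 - 2 * x ≠ 0 := by
      simpa using natCast_sub_one_sub_ne_zero 0 h2 h3
    have m2 : (0 : ℂ) - 2 * x ≠ 0 := ne_zero_of_re_pos (by simp; linarith)
    have m3 : (0 : ℂ) + 3 / 2 + x ≠ 0 := ne_zero_of_re_pos (by simp; linarith)
    simp only [prodTerm, Finset.range_zero, Finset.prod_empty, Nat.cast_zero]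
    rw [← mul_div_assoc, eq_div_iff (mul_ne_zero (mul_ne_zero m1 m2) m3)]
    ring
  | succ n ih =>
    have hn := n.cast_nonneg (α := ℝ)
    have e1 : ((n : ℂ) + 3 / 2) ^ 2 - x ^ 2 = (n + 3 / 2 - x) * (n + 3 / 2 + x) := by ring
    have e2 : ((n : ℂ) + 3 / 2) ^ 2 - (x + 1) ^ 2 = (n + 1 / 2 - x) * (n + 5 / 2 + x) := by ring
    have n1 : (n : ℂ) + 3 / 2 - x ≠ 0 := ne_zero_of_re_pos (by simp; linarith)
    have n2 : (n : ℂ) + 3 / 2 + x ≠ 0 := ne_zero_of_re_pos (by simp; linarith)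
    have n3 : (n : ℂ) + 1 / 2 - x ≠ 0 := ne_zero_of_re_pos (by simp; linarith)
    have n4 : (n : ℂ) + 5 / 2 + x ≠ 0 := ne_zero_of_re_pos (by simp; linarith)
    have n5 : (n : ℂ) - 2 * x ≠ 0 := ne_zero_of_re_pos (by simp; linarith)
    have n6 : (n : ℂ) + 1 - 2 * x ≠ 0 := ne_zero_of_re_pos (by simp; linarith)
    have n7 := natCast_sub_one_sub_ne_zero n h2 h3
    rw [prodTerm_succ, prodTerm_succ, e1, e2, ← mul_assoc, ih]
    push_cast
    rw [show (n : ℂ) + 1 - 1 - 2 * x = n - 2 * x by ring,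
      show (n : ℂ) + 1 + 3 / 2 + x = n + 5 / 2 + x by ring,
      show (n : ℂ) + 1 + 1 / 2 - x = n + 3 / 2 - x by ring]
    rw [← mul_assoc (x * (x + 3 / 2))]
    generalize x * (x + 3 / 2) * prodTerm n x = c
    rw [mul_assoc c, mul_assoc c]
    congr 1
    rw [div_mul_div_comm, div_mul_div_comm, div_eq_div_iff]
    · ring
    all_goals simp only [ne_eq, mul_eq_zero, not_or]; tauto

/-- Isolates the division: with `a = n - 1 - 2x`, `b = n - 2x`, `c = n + 3/2 + x`, the certificate
reduces to the polynomial identity `h`. -/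
theorem telescoping_identity {a b c : ℂ} (ha : a ≠ 0) (hb : b ≠ 0) (hc : c ≠ 0)
    {N P Q A B X d : ℂ} (h : N ^ 2 * P - (a * b * c) ^ 2 * Q = -(A * a ^ 2) + B * c ^ 2) :
    (X * (N / (a * b * c))) ^ 2 * d * P - X ^ 2 * d * Q =
      -(X ^ 2 * d * (A / (c ^ 2 * b ^ 2))) - -(X ^ 2 * d * (B / (a ^ 2 * b ^ 2))) := by
  field_simp
  linear_combination X ^ 2 * d * h

theorem term_add_one_sub (n : ℕ) {x : ℂ} (h1 : -1 < x.re) (h2 : x.re < 0)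
    (h3 : 2 * x + 1 ≠ 0) :
    ((1 + x) * (1 / 2 - x)) ^ 2 * term n (x + 1) - (x * (x + 3 / 2)) ^ 2 * term n x =
      companion (n + 1) x - companion n x := by
  have hn := n.cast_nonneg (α := ℝ)
  have n1 : (n : ℂ) + 3 / 2 - x ≠ 0 := ne_zero_of_re_pos (by simp; linarith)
  have n2 : (n : ℂ) + 3 / 2 + x ≠ 0 := ne_zero_of_re_pos (by simp; linarith)
  have n3 : (n : ℂ) - 2 * x ≠ 0 := ne_zero_of_re_pos (by simp; linarith)
  have n4 := natCast_sub_one_sub_ne_zero n h2 h3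
  have n5 : (n : ℂ) + 1 - 2 * x ≠ 0 := ne_zero_of_re_pos (by simp; linarith)
  have n6 : (n : ℂ) + 3 / 2 ≠ 0 := ne_zero_of_re_pos (by simp; linarith)
  have e1 : ((n : ℂ) + 3 / 2) ^ 2 - x ^ 2 = (n + 3 / 2 - x) * (n + 3 / 2 + x) := by ring
  -- Expressed through `prodTerm n x` and `coeff n`, all four terms of the identity share the same
  -- transcendental factor.
  have hF : companion (n + 1) x = -((x * (x + 3 / 2) * prodTerm n x) ^ 2 * coeff n *
      (2 * (2 * x + 1) * (n + 1) ^ 4 * (n + 1 + 2 * x) ^ 2 /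
        ((n + 3 / 2 + x) ^ 2 * (n - 2 * x) ^ 2))) := by
    unfold companion
    rw [prodTerm_succ, coeff_succ, e1]
    push_cast
    rw [show (n : ℂ) + 1 - 1 - 2 * x = n - 2 * x by ring,
      show (n : ℂ) + 1 + 1 / 2 - x = n + 3 / 2 - x by ring,
      show (n : ℂ) + 1 + 1 / 2 = n + 3 / 2 by ring]
    generalize (n : ℂ) = y at *
    generalize prodTerm n x = c
    generalize (coeff n : ℂ) = d
    have e3 : (y + 1) ^ 2 - 4 * x ^ 2 = (y + 1 - 2 * x) * (y + 1 + 2 * x) := by ring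
    rw [e3]
    generalize y + 3 / 2 - x = a at *
    generalize y + 3 / 2 + x = b at *
    generalize y + 1 - 2 * x = v at *
    generalize y + 1 + 2 * x = t at *
    generalize y - 2 * x = w at *
    generalize y + 3 / 2 = s at *
    generalize 2 * x + 1 = r at *
    generalize x * (x + 3 / 2) = q at *
    field_simp
    ring
  have hT : ((1 + x) * (1 / 2 - x)) ^ 2 * term n (x + 1) =
      ((1 + x) * (1 / 2 - x) * prodTerm n (x + 1)) ^ 2 * coeff n * poly n (x + 1) := by
    unfold term
    ring
  rw [hT, prodTerm_add_one n h1 h2 h3, hF]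
  have hL : (x * (x + 3 / 2)) ^ 2 * term n x =
      (x * (x + 3 / 2) * prodTerm n x) ^ 2 * coeff n * poly n x := by
    unfold term
    ring
  rw [hL]
  refine telescoping_identity n4 n3 n2 ?_
  unfold poly
  ring

/-! ### Convergence on the strip and the recurrence for the sum. -/

theorem norm_factor_le (j : ℕ) {x : ℂ} (hx : |x.re| ≤ 1) :
    ‖(((j : ℂ) + 1) ^ 2 - 4 * x ^ 2) / (((j : ℂ) + 3 / 2) ^ 2 - x ^ 2)‖ ≤ 4 := by
  have hj := j.cast_nonneg (α := ℝ)
  rw [norm_div]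
  refine div_le_of_le_mul₀ (norm_nonneg _) (by norm_num) ?_
  rw [← sq_le_sq₀ (norm_nonneg _) (by positivity), mul_pow, Complex.sq_norm, Complex.sq_norm,
    Complex.normSq_apply, Complex.normSq_apply]
  have hre : x.re ^ 2 ≤ 1 := by rw [← sq_abs]; nlinarith [abs_nonneg x.re]
  have e1 : ((((j : ℂ) + 1) ^ 2 - 4 * x ^ 2)).re = ((j : ℝ) + 1) ^ 2 - 4 * (x.re ^ 2 - x.im ^ 2) := by
    simp [pow_two]
  have e2 : ((((j : ℂ) + 1) ^ 2 - 4 * x ^ 2)).im = - 8 * (x.re * x.im) := by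
    simp [pow_two]; ring
  have e3 : ((((j : ℂ) + 3 / 2) ^ 2 - x ^ 2)).re = ((j : ℝ) + 3 / 2) ^ 2 - (x.re ^ 2 - x.im ^ 2) := by
    simp [pow_two]
  have e4 : ((((j : ℂ) + 3 / 2) ^ 2 - x ^ 2)).im = - 2 * (x.re * x.im) := by
    simp [pow_two]; ring
  rw [e1, e2, e3, e4]
  -- For real `a`, `b`, `|a - w|² - |b - w|² = (a - b)(a + b - 2 Re w)`, applied with `w = 4x²` and
  -- divided by `16`.
  have h : 0 ≤ (((j : ℝ) + 3 / 2) ^ 2 - ((j : ℝ) + 1) ^ 2 / 4) *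
      (((j : ℝ) + 3 / 2) ^ 2 + ((j : ℝ) + 1) ^ 2 / 4 - 2 * (x.re ^ 2 - x.im ^ 2)) := by
    apply mul_nonneg <;> nlinarith [sq_nonneg x.im]
  nlinarith

theorem norm_prodTerm_le (n : ℕ) {x : ℂ} (hx : |x.re| ≤ 1) : ‖prodTerm n x‖ ≤ 4 ^ n := by
  induction n with
  | zero => simp [prodTerm]
  | succ n ih =>
    rw [prodTerm_succ, norm_mul, pow_succ (4 : ℝ)]
    exact mul_le_mul ih (norm_factor_le n hx) (norm_nonneg _) (by positivity)

theorem norm_prodTerm_sq_mul_coeff_le (n : ℕ) {x : ℂ} (hx : |x.re| ≤ 1) :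
    ‖prodTerm n x ^ 2 * coeff n‖ ≤ 8 * (1 / 4) ^ n := by
  rw [norm_mul, norm_pow, Complex.norm_real, Real.norm_of_nonneg (coeff_nonneg n)]
  calc _ ≤ ((4 : ℝ) ^ n) ^ 2 * (8 * (1 / 64) ^ n) := by
        gcongr
        · exact coeff_nonneg n
        · exact norm_prodTerm_le n hx
        · exact coeff_le n
    _ = 8 * (4 * 4 * (1 / 64)) ^ n := by rw [mul_pow, mul_pow]; ring
    _ = _ := by norm_num

/-- Squaring the bound `4ⁿ` on the product against `64⁻ⁿ` leaves `4⁻ⁿ`, whatever `Im x`. Only `poly`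
grows with `x`, quadratically, which the decay of `kernel ^ 2` will offset. -/
theorem norm_term_le (n : ℕ) {x : ℂ} (hx : |x.re| ≤ 1) :
    ‖term n x‖ ≤ 216 * (1 + ‖x‖ ^ 2) * (((n : ℝ) + 1) ^ 4 * (1 / 4) ^ n) := by
  have hn := n.cast_nonneg (α := ℝ)
  have hp : ‖poly n x‖ ≤ 27 * (1 + ‖x‖ ^ 2) * ((n : ℝ) + 1) ^ 4 := by
    unfold poly
    rw [norm_mul]
    have h1 : ‖(3 * n + 2 : ℂ)‖ ≤ 3 * ((n : ℝ) + 1) := by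
      refine (norm_add_le _ _).trans ?_
      simp
      linarith
    have h2 : ‖(7 * n ^ 2 + 9 * n + 3 - 4 * x ^ 2 : ℂ)‖ ≤ 9 * (1 + ‖x‖ ^ 2) * ((n : ℝ) + 1) ^ 2 := by
      have h3 : ‖(7 * n ^ 2 + 9 * n + 3 : ℂ)‖ = 7 * (n : ℝ) ^ 2 + 9 * n + 3 := by
        rw [show (7 * n ^ 2 + 9 * n + 3 : ℂ) = ((7 * (n : ℝ) ^ 2 + 9 * n + 3 : ℝ) : ℂ) by
          push_cast; rfl, Complex.norm_real, Real.norm_of_nonneg (by positivity)]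
      refine (norm_sub_le _ _).trans ?_
      rw [h3]
      simp only [norm_mul, norm_pow, Complex.norm_ofNat]
      nlinarith [mul_nonneg hn (sq_nonneg ‖x‖), mul_nonneg (sq_nonneg (n : ℝ)) (sq_nonneg ‖x‖),
        sq_nonneg ‖x‖]
    calc _ ≤ 3 * ((n : ℝ) + 1) * (9 * (1 + ‖x‖ ^ 2) * ((n : ℝ) + 1) ^ 2) := by gcongr
      _ = 27 * (1 + ‖x‖ ^ 2) * ((n : ℝ) + 1) ^ 3 := by ring
      _ ≤ _ := by gcongr <;> linarith
  unfold term
  rw [norm_mul]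
  calc _ ≤ 8 * (1 / 4) ^ n * (27 * (1 + ‖x‖ ^ 2) * ((n : ℝ) + 1) ^ 4) :=
        mul_le_mul (norm_prodTerm_sq_mul_coeff_le n hx) hp (norm_nonneg _) (by positivity)
    _ = _ := by ring

theorem summable_term {x : ℂ} (hx : |x.re| ≤ 1) : Summable fun n => term n x :=
  Summable.of_norm_bounded
    (RamanujanPiCubed.summable_pow_four_mul_geometric.mul_left (216 * (1 + ‖x‖ ^ 2)))
    fun n => norm_term_le n hx

theorem tendsto_companion {x : ℂ} (h1 : -1 < x.re) (h2 : x.re < 0) :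
    Tendsto (fun n => companion n x) atTop (𝓝 0) := by
  have hx : |x.re| ≤ 1 := abs_le.2 ⟨h1.le, by linarith⟩
  have hd : 0 < -2 * x.re := by linarith
  have hs : Tendsto (fun n : ℕ => ((n : ℝ) + 1) ^ 6 * (1 / 4) ^ n) atTop (𝓝 0) := by
    have h : Summable fun n : ℕ => (n : ℝ) ^ 6 * (1 / 4 : ℝ) ^ n :=
      summable_pow_mul_geometric_of_norm_lt_one 6 (by norm_num)
    refine (((summable_nat_add_iff 1).2 h).mul_left 4).tendsto_atTop_zero.congr fun n => ?_
    push_cast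
    ring
  have hlim := hs.const_mul (‖x * (x + 3 / 2)‖ ^ 2 * 8 * (128 * ‖2 * x + 1‖ * (1 + ‖x‖) ^ 2 /
    ((-2 * x.re) ^ 2 * (-2 * x.re) ^ 2)))
  rw [mul_zero] at hlim
  refine squeeze_zero_norm' ?_ hlim
  -- For `n ≥ 1` both `n - 1 - 2x` and `n - 2x` have real part at least `-2 Re x > 0`.
  filter_upwards [eventually_ge_atTop 1] with n hn
  have hn' : (1 : ℝ) ≤ n := by exact_mod_cast hn
  have d1 : -2 * x.re ≤ ‖(n - 1 - 2 * x : ℂ)‖ := by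
    refine le_trans ?_ (Complex.re_le_norm _)
    simp; linarith
  have d2 : -2 * x.re ≤ ‖(n - 2 * x : ℂ)‖ := by
    refine le_trans ?_ (Complex.re_le_norm _)
    simp
  have u1 : ‖(n + 1 / 2 - x : ℂ)‖ ≤ (1 + ‖x‖) * (n + 1) := by
    refine (norm_sub_le _ _).trans ?_
    have : ‖(n + 1 / 2 : ℂ)‖ ≤ n + 1 / 2 := (norm_add_le _ _).trans (by simp)
    nlinarith [norm_nonneg x]
  have u2 : ‖(n + 1 / 2 : ℂ)‖ ≤ n + 1 := (norm_add_le _ _).trans (by simp; norm_num)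
  have hq : ‖128 * (2 * x + 1) * n * (n + 1 / 2) ^ 3 * (n + 1 / 2 - x) ^ 2 /
      ((n - 1 - 2 * x) ^ 2 * (n - 2 * x) ^ 2)‖ ≤ 128 * ‖2 * x + 1‖ * (n + 1) * (n + 1) ^ 3 *
        ((1 + ‖x‖) * (n + 1)) ^ 2 / ((-2 * x.re) ^ 2 * (-2 * x.re) ^ 2) := by
    simp only [norm_div, norm_mul, norm_pow, Complex.norm_ofNat, Complex.norm_natCast] at *
    gcongr
    linarith
  have e : companion n x = -((x * (x + 3 / 2)) ^ 2 * (prodTerm n x ^ 2 * coeff n) *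
    (128 * (2 * x + 1) * n * (n + 1 / 2) ^ 3 * (n + 1 / 2 - x) ^ 2 /
      ((n - 1 - 2 * x) ^ 2 * (n - 2 * x) ^ 2))) := by
    unfold companion
    ring
  rw [e, norm_neg, norm_mul, norm_mul, norm_pow]
  calc _ ≤ ‖x * (x + 3 / 2)‖ ^ 2 * (8 * (1 / 4) ^ n) * _ :=
        mul_le_mul (mul_le_mul_of_nonneg_left (norm_prodTerm_sq_mul_coeff_le n hx)
          (by positivity)) hq (norm_nonneg _) (by positivity)
    _ = _ := by ring

theorem companion_zero (x : ℂ) : companion 0 x = 0 := by simp [companion]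

theorem tsum_term_add_one {x : ℂ} (h1 : -1 < x.re) (h2 : x.re < 0) :
    ((1 + x) * (1 / 2 - x)) ^ 2 * ∑' n, term n (x + 1) =
      (x * (x + 3 / 2)) ^ 2 * ∑' n, term n x := by
  -- At `x = -1/2` the certificate has a vanishing denominator at `n = 0`; there `x + 1 = -x`, and
  -- evenness of `term` suffices.
  by_cases h3 : 2 * x + 1 = 0
  · have hx : x = -(1 / 2) := by linear_combination h3 / 2
    have h4 : ∀ n, term n (x + 1) = term n x := fun n => by
      rw [← term_neg n x, hx]
      norm_num
    rw [tsum_congr h4, hx]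
    ring
  · have s1 := summable_term (x := x + 1) (by simp; exact abs_le.2 ⟨by linarith, by linarith⟩)
    have s2 := summable_term (x := x) (abs_le.2 ⟨by linarith, by linarith⟩)
    rw [← tsum_mul_left, ← tsum_mul_left, ← sub_eq_zero,
      ← (s1.mul_left _).tsum_sub (s2.mul_left _)]
    refine tendsto_nhds_unique ((s1.mul_left _).sub (s2.mul_left _)).hasSum.tendsto_sum_nat ?_
    simp only [term_add_one_sub _ h1 h2 h3, Finset.sum_range_sub (fun n => companion n x),
      companion_zero, sub_zero]
    exact tendsto_companion h1 h2

/-! ### Holomorphy, periodic normalisation and Liouville. -/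

theorem differentiableAt_term (n : ℕ) {x : ℂ} (hx : |x.re| < 1) :
    DifferentiableAt ℂ (term n) x := by
  have hx' := abs_lt.1 hx
  have hp : DifferentiableAt ℂ (prodTerm n) x := by
    induction n with
    | zero =>
      rw [show prodTerm 0 = fun _ => 1 by ext; simp [prodTerm]]
      exact differentiableAt_const _
    | succ n ih =>
      have hn := n.cast_nonneg (α := ℝ)
      have hd : ((n : ℂ) + 3 / 2) ^ 2 - x ^ 2 ≠ 0 := by
        rw [sq_sub_sq]
        exact mul_ne_zero (ne_zero_of_re_pos (by simp; linarith))
          (ne_zero_of_re_pos (by simp; linarith))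
      rw [show prodTerm (n + 1) = _ from funext (prodTerm_succ n)]
      exact ih.mul (DifferentiableAt.div (by fun_prop) (by fun_prop) hd)
  unfold term poly
  fun_prop

theorem differentiableAt_tsum_term {x : ℂ} (hx : |x.re| < 1) :
    DifferentiableAt ℂ (fun x => ∑' n, term n x) x := by
  have ho : IsOpen ({z : ℂ | |z.re| < 1} ∩ Metric.ball 0 (‖x‖ + 1)) :=
    (isOpen_lt (by fun_prop) (by fun_prop)).inter Metric.isOpen_ball
  refine (Complex.differentiableOn_tsum_of_summable_norm (F := term)
    (RamanujanPiCubed.summable_pow_four_mul_geometric.mul_left (216 * (1 + (‖x‖ + 1) ^ 2)))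
    (fun n z hz => (differentiableAt_term n hz.1).differentiableWithinAt) ho
    (fun n z hz => ?_)).differentiableAt (ho.mem_nhds ⟨hx, by simp⟩)
  have hz2 : ‖z‖ ≤ ‖x‖ + 1 := by simpa using (Metric.mem_ball.1 hz.2).le
  refine (norm_term_le n hz.1.le).trans ?_
  gcongr

/-- The Gamma quotient that makes the deformed sum periodic. -/
noncomputable def kernel (x : ℂ) : ℂ :=
  Complex.Gamma (1 + x) * Complex.Gamma (1 - x) *
    ((Complex.Gamma (3 / 2 + x))⁻¹ * (Complex.Gamma (3 / 2 - x))⁻¹)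

theorem differentiableAt_Gamma_of_re_pos {z : ℂ} (h : 0 < z.re) :
    DifferentiableAt ℂ Complex.Gamma z := by
  refine Complex.differentiableAt_Gamma z fun m hm => ?_
  rw [hm] at h
  simp at h
  linarith [m.cast_nonneg (α := ℝ)]

theorem differentiableAt_kernel {x : ℂ} (hx : |x.re| < 1) : DifferentiableAt ℂ kernel x := by
  have hx' := abs_lt.1 hx
  have g1 : DifferentiableAt ℂ (fun x => Complex.Gamma (1 + x)) x :=
    DifferentiableAt.comp x (g := Complex.Gamma)
      (differentiableAt_Gamma_of_re_pos (by simp; linarith)) (by fun_prop)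
  have g2 : DifferentiableAt ℂ (fun x => Complex.Gamma (1 - x)) x :=
    DifferentiableAt.comp x (g := Complex.Gamma)
      (differentiableAt_Gamma_of_re_pos (by simp; linarith)) (by fun_prop)
  have g3 : DifferentiableAt ℂ (fun x => (Complex.Gamma (3 / 2 + x))⁻¹) x :=
    DifferentiableAt.comp x (g := fun s => (Complex.Gamma s)⁻¹)
      Complex.differentiable_one_div_Gamma.differentiableAt (by fun_prop)
  have g4 : DifferentiableAt ℂ (fun x => (Complex.Gamma (3 / 2 - x))⁻¹) x :=
    DifferentiableAt.comp x (g := fun s => (Complex.Gamma s)⁻¹)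
      Complex.differentiable_one_div_Gamma.differentiableAt (by fun_prop)
  exact (g1.mul g2).mul (g3.mul g4)

/-- Inverts the multiplier in the recurrence of the sum up to a sign, which disappears because
`normalizedSum` uses `kernel ^ 2`. -/
theorem kernel_add_one {x : ℂ} (h1 : -1 < x.re) (h2 : x.re < 0) :
    kernel (x + 1) * (x * (x + 3 / 2)) = -(kernel x * ((1 + x) * (1 / 2 - x))) := by
  have n0 : -x ≠ 0 := ne_zero_of_re_pos (by simp; linarith)
  have n1 : 1 + x ≠ 0 := ne_zero_of_re_pos (by simp; linarith)
  have n2 : 3 / 2 + x ≠ 0 := ne_zero_of_re_pos (by simp; linarith)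
  have n3 : 1 / 2 - x ≠ 0 := ne_zero_of_re_pos (by simp; linarith)
  have g1 := Complex.Gamma_add_one _ n1
  have g2 := Complex.Gamma_add_one _ n0
  have g3 := Complex.Gamma_add_one _ n2
  have g4 := Complex.Gamma_add_one _ n3
  unfold kernel
  rw [show 1 + (x + 1) = 1 + x + 1 by ring, show 1 - (x + 1) = -x by ring,
    show 3 / 2 + (x + 1) = 3 / 2 + x + 1 by ring, show 3 / 2 - (x + 1) = 1 / 2 - x by ring,
    show 1 - x = -x + 1 by ring, show 3 / 2 - x = 1 / 2 - x + 1 by ring, g1, g2, g3, g4,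
    mul_inv, mul_inv]
  linear_combination (1 + x) * x * Complex.Gamma (1 + x) * Complex.Gamma (-x) *
    (Complex.Gamma (3 / 2 + x))⁻¹ * (Complex.Gamma (1 / 2 - x))⁻¹ *
      (inv_mul_cancel₀ n2 - inv_mul_cancel₀ n3)

/-- The deformed sum, normalised so that it is periodic in `x`. -/
noncomputable def normalizedSum (x : ℂ) : ℂ := kernel x ^ 2 * ∑' n, term n x

theorem normalizedSum_add_one {x : ℂ} (h1 : -1 < x.re) (h2 : x.re < 0) :
    normalizedSum (x + 1) = normalizedSum x := by
  have n0 : x ≠ 0 := by rintro rfl; simp at h2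
  have n2 : x + 3 / 2 ≠ 0 := ne_zero_of_re_pos (by simp; linarith)
  have hk := kernel_add_one h1 h2
  have hs := tsum_term_add_one h1 h2
  have hne : (x * (x + 3 / 2)) ^ 2 ≠ 0 := pow_ne_zero _ (mul_ne_zero n0 n2)
  refine mul_right_cancel₀ hne ?_
  unfold normalizedSum
  calc _ = (kernel (x + 1) * (x * (x + 3 / 2))) ^ 2 * ∑' n, term n (x + 1) := by ring
    _ = kernel x ^ 2 * (((1 + x) * (1 / 2 - x)) ^ 2 * ∑' n, term n (x + 1)) := by rw [hk]; ring
    _ = _ := by rw [hs]; ring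

theorem differentiableAt_normalizedSum {x : ℂ} (hx : |x.re| < 1) :
    DifferentiableAt ℂ normalizedSum x :=
  ((differentiableAt_kernel hx).pow 2).mul (differentiableAt_tsum_term hx)

/-- A bounded holomorphic function on the strip `|re z| < 1` with period `1` is constant. -/
theorem eq_of_periodic_of_bounded_on_strip {f : ℂ → ℂ} {C : ℝ}
    (hd : ∀ z : ℂ, |z.re| < 1 → DifferentiableAt ℂ f z)
    (hp : ∀ z : ℂ, -1 < z.re → z.re < 0 → f (z + 1) = f z)
    (hb : ∀ z : ℂ, |z.re| ≤ 1 / 2 → ‖f z‖ ≤ C) {z w : ℂ} (hz : |z.re| < 1) (hw : |w.re| < 1) :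
    f z = f w := by
  let g : ℂ → ℂ := fun z => f (z - round z.re)
  -- Allowing every `m` within distance `1`, not just the nearest integer, makes `g` holomorphic
  -- across the lines where the rounding jumps.
  have hg : ∀ (m : ℤ) (z : ℂ), |z.re - m| < 1 → g z = f (z - m) := by
    intro m z hm
    have h1 := abs_le.1 (abs_sub_round z.re)
    have h2 := abs_lt.1 hm
    have h3 : round z.re < m + 2 := by
      have : (round z.re : ℝ) < m + 2 := by linarith
      exact_mod_cast this
    have h4 : m - 2 < round z.re := by
      have : (m : ℝ) - 2 < round z.re := by linarith
      exact_mod_cast this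
    have h5 : round z.re = m ∨ round z.re = m + 1 ∨ round z.re = m - 1 := by omega
    rcases h5 with h | h | h
    · simp only [g, h]
    · simp only [g, h]
      rw [h] at h1
      push_cast at h1 ⊢
      rw [← hp]
      · congr 1; ring
      · simp; linarith
      · simp; linarith
    · simp only [g, h]
      rw [h] at h1
      push_cast at h1 ⊢
      rw [← hp (z - m)]
      · congr 1; ring
      · simp; linarith
      · simp; linarith
  have hgd : Differentiable ℂ g := by
    intro z
    have hm : |z.re - round z.re| < 1 := (abs_sub_round z.re).trans_lt (by norm_num)
    have he : g =ᶠ[𝓝 z] fun y => f (y - round z.re) := by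
      have ho : IsOpen {y : ℂ | |y.re - round z.re| < 1} := isOpen_lt (by fun_prop) (by fun_prop)
      filter_upwards [ho.mem_nhds hm] with y hy using hg _ _ hy
    refine DifferentiableAt.congr_of_eventuallyEq ?_ he
    exact DifferentiableAt.comp z (g := f) (hd _ (by simpa using hm)) (by fun_prop)
  have hgb : Bornology.IsBounded (Set.range g) := by
    refine isBounded_iff_forall_norm_le.2 ⟨C, ?_⟩
    rintro _ ⟨z, rfl⟩
    exact hb _ (by simpa using abs_sub_round z.re)
  have := hgd.apply_eq_apply_of_bounded hgb z w
  rwa [hg 0 z (by simpa using hz), hg 0 w (by simpa using hw), Int.cast_zero, sub_zero,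
    sub_zero] at this

/-! ### Boundedness of the normalised sum. -/

theorem norm_sin_ge (z : ℂ) : |Real.sinh z.im| ≤ ‖Complex.sin z‖ := by
  have h : Complex.sin z = ((Real.sin z.re * Real.cosh z.im : ℝ) : ℂ) +
      ((Real.cos z.re * Real.sinh z.im : ℝ) : ℂ) * Complex.I := by
    rw [Complex.sin_eq]
    push_cast
    rfl
  rw [← sq_le_sq₀ (abs_nonneg _) (norm_nonneg _), sq_abs, Complex.sq_norm, h,
    Complex.normSq_add_mul_I]
  nlinarith [Real.cosh_sq z.im, Real.sin_sq_add_cos_sq z.re, sq_nonneg (Real.sin z.re)]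

/-- The reflection formula at `x` and at `1/2 + x`; away from the real axis the cotangent is
bounded, so `kernel` decays like `1/|x|`. -/
theorem kernel_eq {x : ℂ} (hx : x ≠ 0) (h1 : 1 / 2 + x ≠ 0) (h2 : 1 / 2 - x ≠ 0) :
    kernel x = x * Complex.cos (Real.pi * x) /
      (Complex.sin (Real.pi * x) * ((1 / 2 + x) * (1 / 2 - x))) := by
  have g1 := Complex.Gamma_add_one _ hx
  have g3 := Complex.Gamma_add_one _ h1
  have g4 := Complex.Gamma_add_one _ h2
  have r1 := Complex.Gamma_mul_Gamma_one_sub x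
  have r2 := Complex.Gamma_mul_Gamma_one_sub (1 / 2 + x)
  rw [show 1 - (1 / 2 + x) = 1 / 2 - x by ring,
    show (Real.pi : ℂ) * (1 / 2 + x) = Real.pi * x + Real.pi / 2 by ring,
    Complex.sin_add_pi_div_two] at r2
  have hpi : (Real.pi : ℂ) ≠ 0 := by exact_mod_cast Real.pi_ne_zero
  unfold kernel
  rw [show 1 + x = x + 1 by ring, show 3 / 2 + x = 1 / 2 + x + 1 by ring,
    show 3 / 2 - x = 1 / 2 - x + 1 by ring, g1, g3, g4]
  calc _ = x * (Complex.Gamma x * Complex.Gamma (1 - x)) * ((1 / 2 + x) * (1 / 2 - x))⁻¹ *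
        (Complex.Gamma (1 / 2 + x) * Complex.Gamma (1 / 2 - x))⁻¹ := by
        simp only [mul_inv]; ring
    _ = _ := by
        rw [r1, r2, inv_div]
        field_simp

theorem norm_kernel_sq_mul_le {x : ℂ} (hx : 1 ≤ |x.im|) :
    ‖kernel x‖ ^ 2 * (1 + ‖x‖ ^ 2) ≤ 8 := by
  have hnx : 1 ≤ ‖x‖ := hx.trans (Complex.abs_im_le_norm x)
  have him : x.im ≠ 0 := by rintro h; norm_num [h] at hx
  have h0 : x ≠ 0 := by rintro rfl; simp at him
  have h1 : 1 / 2 + x ≠ 0 := fun h => him (by simpa using congrArg Complex.im h)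
  have h2 : 1 / 2 - x ≠ 0 := fun h => him (by simpa using congrArg Complex.im h)
  have hs : 1 ≤ ‖Complex.sin (Real.pi * x)‖ := by
    refine le_trans ?_ (norm_sin_ge _)
    have e : ((Real.pi : ℂ) * x).im = Real.pi * x.im := by simp
    rw [e, Real.abs_sinh, abs_mul, abs_of_pos Real.pi_pos]
    refine le_trans ?_ (Real.self_le_sinh_iff.2 (by positivity))
    nlinarith [Real.pi_gt_three]
  have hc : ‖Complex.cos (Real.pi * x)‖ ^ 2 ≤ 2 * ‖Complex.sin (Real.pi * x)‖ ^ 2 := by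
    rw [← norm_pow, Complex.cos_sq']
    refine (norm_sub_le _ _).trans ?_
    rw [norm_one, norm_pow]
    nlinarith
  have hq : 3 / 4 * ‖x‖ ^ 2 ≤ ‖(1 / 2 + x) * (1 / 2 - x)‖ := by
    rw [show (1 / 2 + x) * (1 / 2 - x) = -(x ^ 2 - 1 / 4) by ring, norm_neg]
    have := norm_sub_norm_le (x ^ 2) (1 / 4)
    rw [norm_pow] at this
    norm_num at this
    nlinarith
  rw [kernel_eq h0 h1 h2, norm_div, norm_mul, norm_mul, div_pow, mul_pow, mul_pow, div_mul_eq_mul_div]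
  refine div_le_of_le_mul₀ (by positivity) (by norm_num) ?_
  have hq2 : 9 / 16 * ‖x‖ ^ 4 ≤ ‖(1 / 2 + x) * (1 / 2 - x)‖ ^ 2 := by
    calc _ = (3 / 4 * ‖x‖ ^ 2) ^ 2 := by ring
      _ ≤ _ := by gcongr
  -- The constants combine to `2 · 2 / (9/16) = 64/9 ≤ 8`.
  have hx2 : 1 + ‖x‖ ^ 2 ≤ 2 * ‖x‖ ^ 2 := by nlinarith
  calc ‖x‖ ^ 2 * ‖Complex.cos (Real.pi * x)‖ ^ 2 * (1 + ‖x‖ ^ 2)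
      ≤ ‖x‖ ^ 2 * (2 * ‖Complex.sin (Real.pi * x)‖ ^ 2) * (2 * ‖x‖ ^ 2) := by gcongr
    _ = 4 * ‖Complex.sin (Real.pi * x)‖ ^ 2 * ‖x‖ ^ 4 := by ring
    _ ≤ 8 * ‖Complex.sin (Real.pi * x)‖ ^ 2 * (9 / 16 * ‖x‖ ^ 4) := by
        have : 0 ≤ ‖Complex.sin (Real.pi * x)‖ ^ 2 * ‖x‖ ^ 4 := by positivity
        nlinarith
    _ ≤ 8 * ‖Complex.sin (Real.pi * x)‖ ^ 2 * ‖(1 / 2 + x) * (1 / 2 - x)‖ ^ 2 := by gcongr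
    _ = _ := by ring

theorem norm_tsum_term_le {x : ℂ} (hx : |x.re| ≤ 1) :
    ‖∑' n, term n x‖ ≤ 216 * (1 + ‖x‖ ^ 2) * ∑' n : ℕ, ((n : ℝ) + 1) ^ 4 * (1 / 4) ^ n := by
  rw [← tsum_mul_left]
  exact tsum_of_norm_bounded
    (RamanujanPiCubed.summable_pow_four_mul_geometric.mul_left _).hasSum
    fun n => norm_term_le n hx

/-- Compactness handles `|Im x| ≤ 1`; beyond it the decay of `kernel ^ 2` offsets the quadratic
growth of the sum. -/
theorem exists_bound_normalizedSum :
    ∃ C : ℝ, ∀ x : ℂ, |x.re| ≤ 1 / 2 → ‖normalizedSum x‖ ≤ C := by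
  have hK : IsCompact (Set.Icc (-(1 / 2 : ℝ)) (1 / 2) ×ℂ Set.Icc (-1 : ℝ) 1) :=
    isCompact_Icc.reProdIm isCompact_Icc
  obtain ⟨C, hC⟩ := hK.exists_bound_of_continuousOn (f := normalizedSum) fun z hz => by
    refine (differentiableAt_normalizedSum ?_).continuousAt.continuousWithinAt
    exact (abs_le.2 hz.1).trans_lt (by norm_num)
  refine ⟨max C (8 * (216 * ∑' n : ℕ, ((n : ℝ) + 1) ^ 4 * (1 / 4) ^ n)), fun x hx => ?_⟩
  rcases le_total |x.im| 1 with h | h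
  · exact (hC x ⟨abs_le.1 hx, abs_le.1 h⟩).trans (le_max_left _ _)
  · refine le_trans ?_ (le_max_right _ _)
    unfold normalizedSum
    rw [norm_mul, norm_pow]
    calc _ ≤ ‖kernel x‖ ^ 2 * (216 * (1 + ‖x‖ ^ 2) *
          ∑' n : ℕ, ((n : ℝ) + 1) ^ 4 * (1 / 4) ^ n) := by
          gcongr
          exact norm_tsum_term_le (hx.trans (by norm_num))
      _ = ‖kernel x‖ ^ 2 * (1 + ‖x‖ ^ 2) *
          (216 * ∑' n : ℕ, ((n : ℝ) + 1) ^ 4 * (1 / 4) ^ n) := by ring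
      _ ≤ _ := by
          have : 0 ≤ ∑' n : ℕ, ((n : ℝ) + 1) ^ 4 * (1 / 4 : ℝ) ^ n :=
            tsum_nonneg fun n => by positivity
          gcongr
          exact norm_kernel_sq_mul_le h

/-! ### Special values and conclusion. -/

theorem Gamma_three_halves : Complex.Gamma (3 / 2) = Complex.Gamma (1 / 2) / 2 := by
  rw [show (3 / 2 : ℂ) = 1 / 2 + 1 by norm_num, Complex.Gamma_add_one _ (by norm_num)]
  ring

theorem Gamma_half_sq : Complex.Gamma (1 / 2) ^ 2 = Real.pi := by
  have := Complex.Gamma_mul_Gamma_one_sub (1 / 2)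
  rw [show (1 : ℂ) - 1 / 2 = 1 / 2 by norm_num, mul_one_div, Complex.sin_pi_div_two] at this
  rw [sq, this, div_one]

theorem normalizedSum_zero :
    normalizedSum 0 = 16 / Real.pi ^ 2 * ∑' n, term n 0 := by
  have hpi : (Real.pi : ℂ) ≠ 0 := by exact_mod_cast Real.pi_ne_zero
  have h : kernel 0 = 4 / Real.pi := by
    unfold kernel
    rw [add_zero, sub_zero, add_zero, sub_zero, Complex.Gamma_one, Gamma_three_halves,
      ← mul_inv, ← Gamma_half_sq]
    ring
  rw [normalizedSum, h]
  ring

theorem normalizedSum_half : normalizedSum (1 / 2) = 8 * Real.pi ^ 2 := by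
  have h : kernel (1 / 2) = Real.pi / 2 := by
    unfold kernel
    rw [show (1 : ℂ) + 1 / 2 = 3 / 2 by norm_num, show (1 : ℂ) - 1 / 2 = 1 / 2 by norm_num,
      show (3 / 2 : ℂ) + 1 / 2 = 1 + 1 by norm_num, show (3 / 2 : ℂ) - 1 / 2 = 1 by norm_num,
      Complex.Gamma_add_one _ one_ne_zero, Complex.Gamma_one, Gamma_three_halves,
      ← Gamma_half_sq]
    ring
  have ht : ∑' n, term n (1 / 2) = 32 := by
    -- The `j = 0` factor of `prodTerm` contains `1 - 4x²`, which vanishes at `x = 1/2`, so every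
    -- term with `n ≥ 1` is zero.
    rw [tsum_eq_single 0]
    · simp [term, prodTerm, poly, coeff_zero]
      norm_num
    · intro n hn
      obtain ⟨m, rfl⟩ := Nat.exists_eq_succ_of_ne_zero hn
      have : prodTerm (m + 1) (1 / 2) = 0 :=
        Finset.prod_eq_zero (Finset.mem_range.2 m.succ_pos) (by norm_num)
      change term (m + 1) (1 / 2) = 0
      rw [term, this]
      ring
  rw [normalizedSum, h, ht]
  ring

theorem tsum_term_zero : ∑' n, term n 0 = (Real.pi ^ 4 / 2 : ℝ) := by
  have hpi : (Real.pi : ℂ) ≠ 0 := by exact_mod_cast Real.pi_ne_zero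
  obtain ⟨C, hC⟩ := exists_bound_normalizedSum
  have h := eq_of_periodic_of_bounded_on_strip (z := 0) (w := 1 / 2)
    (fun z hz => differentiableAt_normalizedSum hz) (fun z h1 h2 => normalizedSum_add_one h1 h2)
    hC (by simp) (by norm_num)
  rw [normalizedSum_zero, normalizedSum_half] at h
  push_cast
  field_simp at h ⊢
  linear_combination h / 8

theorem prodTerm_zero_right (n : ℕ) :
    prodTerm n 0 = ((n.factorial ^ 2 / (2 * pochhammerSymbol (1 / 2) (n + 1)) ^ 2 : ℝ) : ℂ) := by
  induction n with
  | zero => simp [prodTerm, pochhammerSymbol_succ, pochhammerSymbol_zero]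
  | succ n ih =>
    rw [prodTerm_succ, ih, pochhammerSymbol_succ _ (n + 1), Nat.factorial_succ]
    have h1 := pochhammerSymbol_half_pos (n + 1)
    have h2 : (n : ℝ) + 3 / 2 ≠ 0 := by positivity
    have h3 : ((((n : ℂ) + 1) ^ 2 - 4 * 0 ^ 2) / (((n : ℂ) + 3 / 2) ^ 2 - 0 ^ 2)) =
        (((((n : ℝ) + 1) ^ 2) / (((n : ℝ) + 3 / 2) ^ 2) : ℝ) : ℂ) := by
      push_cast; ring
    rw [h3, ← Complex.ofReal_mul]
    congr 1
    push_cast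
    have h4 : (1 / 2 + ((n : ℝ) + 1)) = n + 3 / 2 := by ring
    rw [h4]
    field_simp

/-- With `m = n + 1`, `poly n 0 = (3m - 1)(7m² - 5m + 1)` is the stated cubic in `m`. The factor `4`
is `64 / 2⁴`: `64` from the index shift in `64ⁿ`, `2⁴` from the square of `prodTerm n 0`. -/
theorem term_zero_right (n : ℕ) :
    term n 0 = ((4 * (pochhammerSymbol 1 (n + 1) ^ 7 / pochhammerSymbol (1 / 2) (n + 1) ^ 7 *
      (1 / 2 ^ (6 * (n + 1))) *
      ((21 * ((n + 1 : ℕ) : ℝ) ^ 3 - 22 * ((n + 1 : ℕ) : ℝ) ^ 2 + 8 * ((n + 1 : ℕ) : ℝ) - 1) /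
        ((n + 1 : ℕ) : ℝ) ^ 7)) : ℝ) : ℂ) := by
  have h1 := pochhammerSymbol_half_pos (n + 1)
  have hp : poly n 0 = (((3 * n + 2) * (7 * (n : ℝ) ^ 2 + 9 * n + 3) : ℝ) : ℂ) := by
    simp [poly]
  rw [term, prodTerm_zero_right, hp, ← Complex.ofReal_pow, ← Complex.ofReal_mul,
    ← Complex.ofReal_mul, coeff, pochhammerSymbol_one, Nat.factorial_succ]
  congr 1
  have h64 : (2 : ℝ) ^ (6 * (n + 1)) = 64 ^ n * 64 := by
    rw [pow_mul, pow_succ]; norm_num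
  rw [h64]
  push_cast
  field_simp
  ring

end RamanujanPiFourth

theorem mainTheorem3 :
    HasSum
      (fun n : ℕ =>
        pochhammerSymbol (1 / 2) n ^ 7 / pochhammerSymbol 1 n ^ 7 * (1 / 2 ^ (6 * n)) *
          (168 * (n : ℝ) ^ 3 + 76 * (n : ℝ) ^ 2 + 14 * (n : ℝ) + 1))
      (32 / Real.pi ^ 3) ∧
    HasSum
      (fun n : ℕ+ =>
        pochhammerSymbol 1 (n : ℕ) ^ 7 / pochhammerSymbol (1 / 2) (n : ℕ) ^ 7 *
          (1 / 2 ^ (6 * (n : ℕ))) *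
          ((21 * ((n : ℕ) : ℝ) ^ 3 - 22 * ((n : ℕ) : ℝ) ^ 2 + 8 * ((n : ℕ) : ℝ) - 1) /
            ((n : ℕ) : ℝ) ^ 7))
      (Real.pi ^ 4 / 8) := by
  constructor
  · simpa only [RamanujanPiCubed.wzG_zero_right] using RamanujanPiCubed.hasSum_wzG_zero
  · have h := (RamanujanPiFourth.summable_term (x := 0) (by simp)).hasSum
    rw [RamanujanPiFourth.tsum_term_zero] at h
    simp only [RamanujanPiFourth.term_zero_right] at h
    have h2 := (Complex.hasSum_ofReal.1 h).div_const 4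
    rw [← Equiv.pnatEquivNat.symm.hasSum_iff]
    rw [show Real.pi ^ 4 / 8 = Real.pi ^ 4 / 2 / 4 by ring]
    refine Eq.subst (motive := fun f => HasSum f _) (funext fun n => ?_) h2
    simp only [Function.comp_apply, Equiv.pnatEquivNat_symm_apply, Nat.succPNat_coe,
      Nat.succ_eq_add_one]
    ring
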